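/- All graphs are finite, simple and undirected. A tree-decomposition of a graph $G$ is a pair $\mathcal T=(T,\{B_t\}_{t\in V(T)})$ where $T$ is a tree and every bag $B_t$ is a subset of $V(G)$, such that for each vertex $v\in V(G)$ the set $\{t\in V(T): v\in B_t\}$ is nonempty and induces a connected subgraph of $T$, and for each edge $uv\in E(G)$ there is a node $t\in V(T)$ with $u,v\in B_t$. The independence number of $\mathcal T$ is $\max_{t\in V(T)}\alpha(G[B_t])$, where $\alpha(H)$ is the maximum size of an independent set in the graph $H$, and the tree-independence number of $G$ is the minimum independence number of a tree-decomposition of $G$. Let $P_5$ be the path with five vertices and $K_{\ell,\ell}$ the complete bipartite graph with both parts of size $\ell$. For every positive integer $\ell$, every graph with no induced subgraph isomorphic to $P_5$ or to $K_{\ell,\ell}$ has tree-independence number at most $4\ell$. -/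

import Mathlib

universe u

namespace SimpleGraph

/-- A tree-decomposition of `G`: a finite tree whose nodes `t` carry bags of vertices of `G`, such
that the nodes whose bag contains a fixed vertex induce a nonempty connected subgraph of the tree,
and any two adjacent vertices of `G` lie in a common bag. As the tree is finite, the universe of its
nodes is immaterial. -/
structure TreeDecomposition {V : Type u} (G : SimpleGraph V) where
  /-- The nodes of the tree. -/
  Node : Type u
  /-- The tree is finite. -/
  fintypeNode : Fintype Node
  /-- The tree. -/
  tree : SimpleGraph Node
  isTree : tree.IsTree
  /-- The bags. -/
  bag : Node → Set V
  /-- `Connected` includes that there is at least one node. -/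
  connected_bags : ∀ v : V, (tree.induce {t | v ∈ bag t}).Connected
  exists_bag_of_adj : ∀ u v : V, G.Adj u v → ∃ t, u ∈ bag t ∧ v ∈ bag t

attribute [instance] TreeDecomposition.fintypeNode

/-- The independence number of a tree-decomposition: the maximum over all nodes of the independence
number of the subgraph induced by the bag. -/
noncomputable def TreeDecomposition.indepNum {V : Type u} {G : SimpleGraph V}
    (D : TreeDecomposition G) : ℕ :=
  Finset.univ.sup fun t : D.Node => (G.induce (D.bag t)).indepNum

/-- The tree-independence number: the minimum independence number of a tree-decomposition. -/
noncomputable def treeIndepNum {V : Type u} (G : SimpleGraph V) : ℕ :=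
  sInf {k | ∃ D : TreeDecomposition G, D.indepNum = k}

/-- The tree-decomposition with one node, whose bag holds all vertices. -/
def TreeDecomposition.trivial {V : Type u} (G : SimpleGraph V) : TreeDecomposition G where
  Node := PUnit
  fintypeNode := inferInstance
  tree := ⊥
  isTree := IsTree.of_subsingleton
  bag _ := Set.univ
  connected_bags v := by
    have : Nonempty {t : PUnit.{u+1} | v ∈ (Set.univ : Set V)} := ⟨⟨PUnit.unit, Set.mem_univ v⟩⟩
    exact ⟨Preconnected.of_subsingleton⟩
  exists_bag_of_adj _ _ _ := ⟨PUnit.unit, Set.mem_univ _, Set.mem_univ _⟩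

/-- The minimum in the definition of the tree-independence number is attained. -/
theorem exists_treeDecomposition_indepNum_eq {V : Type u} (G : SimpleGraph V) :
    ∃ D : TreeDecomposition G, D.indepNum = G.treeIndepNum :=
  Nat.sInf_mem (s := {k | ∃ D : TreeDecomposition G, D.indepNum = k})
    ⟨_, TreeDecomposition.trivial G, rfl⟩

end SimpleGraph

/-! The decomposition is built from the root down. A connected set C with outer neighbourhood S gets
a bag S ∪ Z with Z ⊆ C; the components of C \ Z have their outer neighbourhoods inside this bag and
are treated recursively (`Splittable.rootedDecomposable`). The invariant `Anchored` controls S: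
independent vertices of S that are mixed on C all attach to one connected set B anticomplete to C.
Without induced P₅ they are complete to B, so there are fewer than ℓ of them if B is large, that is,
contains ℓ independent vertices.

Let C be large. Vertices of S complete to C also contribute fewer than ℓ, so α(S) ≤ 2ℓ. In
`Anchored.splittable`, Z is the boundary of a maximal large connected E ⊆ C that misses a vertex of
S or, if there is none, that is anticomplete to another large connected F ⊆ C. In the first case Z
is complete to E; in the second every vertex of S ∪ Z is complete to E or to F. Either way α(S ∪ Z)
≤ 3ℓ, and E or F serves as a new anchor.

If neither kind of E exists, let X be the set of vertices of C whose neighbourhoods have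
independence number above 3ℓ. Then α(X) ≤ ℓ, by `Anchored.not_hasIndep_private` and
`NoInducedBiclique.card_lt_of_private`. Outside X the same recursion, with arbitrary connected sets
in place of large ones, keeps α(S ∪ Z) ≤ 3ℓ, because an independent set in the new bag lies in S,
lies in the neighbourhood of one vertex, or is a single vertex. Adding X to all these bags gives 4ℓ.
-/

namespace SimpleGraph

/-! ### Gluing rooted tree-decompositions. -/

/-- Joining two trees by an edge gives a tree. -/
theorem IsTree.sum_sup_edge {N₁ N₂ : Type*} [Finite N₁] [Finite N₂] {T₁ : SimpleGraph N₁}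
    {T₂ : SimpleGraph N₂} (h₁ : T₁.IsTree) (h₂ : T₂.IsTree) (r₁ : N₁) (r₂ : N₂) :
    ((T₁ ⊕g T₂) ⊔ edge (.inl r₁) (.inr r₂)).IsTree := by
  have hc : ((T₁ ⊕g T₂) ⊔ edge (.inl r₁) (.inr r₂)).Connected :=
    h₁.connected.sum_sup_edge h₂.connected
  refine isTree_iff_connected_and_card.2 ⟨hc, le_antisymm ?_ hc.card_vert_le_card_edgeSet_add_one⟩
  have e₁ := (isTree_iff_connected_and_card.1 h₁).2
  have e₂ := (isTree_iff_connected_and_card.1 h₂).2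
  have hs : Nat.card (T₁ ⊕g T₂).edgeSet = Nat.card T₁.edgeSet + Nat.card T₂.edgeSet := by
    rw [Nat.card_congr edgeSetSumEquiv, Nat.card_sum]
  have hle : Nat.card ((T₁ ⊕g T₂) ⊔ edge (.inl r₁) (.inr r₂)).edgeSet ≤
      Nat.card (T₁ ⊕g T₂).edgeSet + 1 := by
    simp only [Nat.card_coe_set_eq]
    rw [edgeSet_sup]
    refine (Set.ncard_union_le _ _).trans (Nat.add_le_add_left ?_ _)
    refine (Set.ncard_le_ncard (t := {s(Sum.inl r₁, Sum.inr r₂)}) ?_).trans (by simp)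
    rw [edgeSet_edge_of_ne (by simp)]
  rw [Nat.card_sum]
  omega

variable {V : Type u} (G : SimpleGraph V)

/-- Every independent set of `G` inside `s` has at most `k` vertices. -/
def IndepLE (k : ℕ) (s : Set V) : Prop :=
  ∀ M : Finset V, (M : Set V) ⊆ s → G.IsIndepSet (M : Set V) → M.card ≤ k

variable {G}

theorem IndepLE.mono {k l : ℕ} {s t : Set V} (h : G.IndepLE k t) (hst : s ⊆ t) (hkl : k ≤ l) :
    G.IndepLE l s :=
  fun M hM hi => (h M (hM.trans hst) hi).trans hkl

theorem IsIndepSet.subset {s t : Set V} (h : G.IsIndepSet t) (hst : s ⊆ t) : G.IsIndepSet s :=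
  Set.Pairwise.mono hst h

theorem IsIndepSet.not_adj {s : Set V} (h : G.IsIndepSet s) {a b : V} (ha : a ∈ s) (hb : b ∈ s) :
    ¬ G.Adj a b :=
  fun hab => h ha hb hab.ne hab

theorem IndepLE.union {k l : ℕ} {s t : Set V} (hs : G.IndepLE k s) (ht : G.IndepLE l t) :
    G.IndepLE (k + l) (s ∪ t) := by
  classical
  intro M hM hi
  have h1 := hs (M.filter (· ∈ s)) (fun x hx => by simpa using (Finset.mem_filter.1 hx).2)
    (hi.subset (Finset.coe_subset.2 (Finset.filter_subset _ _)))
  have h2 := ht (M.filter (· ∉ s)) (fun x hx => by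
      have hx' := Finset.mem_filter.1 hx
      exact (hM hx'.1).resolve_left hx'.2)
    (hi.subset (Finset.coe_subset.2 (Finset.filter_subset _ _)))
  have h3 := M.card_filter_add_card_filter_not (· ∈ s)
  omega

theorem IndepLE.indepNum_induce_le [Finite V] {k : ℕ} {s : Set V} (h : G.IndepLE k s) :
    (G.induce s).indepNum ≤ k := by
  obtain ⟨M, hM⟩ := (G.induce s).exists_isNIndepSet_indepNum
  rw [← hM.card_eq, ← Finset.card_map (Function.Embedding.subtype (· ∈ s))]
  refine h _ (by simp) ?_
  intro a ha b hb hab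
  simp only [Finset.coe_map, Set.mem_image, Function.Embedding.subtype_apply] at ha hb
  obtain ⟨a, ha, rfl⟩ := ha
  obtain ⟨b, hb, rfl⟩ := hb
  exact fun hadj => hM.isIndepSet ha hb (fun e => hab (congrArg _ e)) hadj

variable (G)

/-- The vertex set `U` has a tree-decomposition with bags of independence number at most `k` and
with a root whose bag contains `Y`. -/
def RootedDecomposable (k : ℕ) (U Y : Set V) : Prop :=
  ∃ (N : Type u) (_ : Finite N) (T : SimpleGraph N) (bag : N → Set V) (r : N),
    T.IsTree ∧ Y ⊆ bag r ∧ (∀ t, bag t ⊆ U) ∧ (∀ t, G.IndepLE k (bag t)) ∧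
    (∀ v ∈ U, (T.induce {t | v ∈ bag t}).Connected) ∧
    ∀ a ∈ U, ∀ b ∈ U, G.Adj a b → ∃ t, a ∈ bag t ∧ b ∈ bag t

variable {G}

theorem RootedDecomposable.of_indepLE {k : ℕ} {U : Set V} (h : G.IndepLE k U) :
    G.RootedDecomposable k U U := by
  refine ⟨PUnit, inferInstance, ⊥, fun _ => U, PUnit.unit, IsTree.of_subsingleton, subset_rfl,
    fun _ => subset_rfl, fun _ => h, fun v hv => ?_, fun a ha b hb _ => ⟨PUnit.unit, ha, hb⟩⟩
  have : Nonempty {t : PUnit.{u+1} | v ∈ U} := ⟨⟨PUnit.unit, hv⟩⟩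
  exact ⟨Preconnected.of_subsingleton⟩

/-- Two rooted decompositions whose vertex sets meet only in both root bags can be glued. -/
theorem RootedDecomposable.union {k : ℕ} {U₁ U₂ Y₁ Y₂ : Set V}
    (h₁ : G.RootedDecomposable k U₁ Y₁) (h₂ : G.RootedDecomposable k U₂ Y₂)
    (hY₁ : U₁ ∩ U₂ ⊆ Y₁) (hY₂ : U₁ ∩ U₂ ⊆ Y₂)
    (hadj : ∀ a ∈ U₁, ∀ b ∈ U₂, G.Adj a b → a ∈ U₂ ∨ b ∈ U₁) :
    G.RootedDecomposable k (U₁ ∪ U₂) Y₁ := by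
  obtain ⟨N₁, _, T₁, b₁, r₁, ht₁, hr₁, hb₁, ha₁, hc₁, he₁⟩ := h₁
  obtain ⟨N₂, _, T₂, b₂, r₂, ht₂, hr₂, hb₂, ha₂, hc₂, he₂⟩ := h₂
  refine ⟨N₁ ⊕ N₂, inferInstance, _, Sum.elim b₁ b₂, .inl r₁, ht₁.sum_sup_edge ht₂ r₁ r₂, hr₁,
    ?_, ?_, ?_, ?_⟩
  · rintro (t | t)
    · exact (hb₁ t).trans Set.subset_union_left
    · exact (hb₂ t).trans Set.subset_union_right
  · rintro (t | t)
    · exact ha₁ t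
    · exact ha₂ t
  · intro v hv
    set T := (T₁ ⊕g T₂) ⊔ edge (Sum.inl r₁) (Sum.inr r₂) with hT
    set A : Set (N₁ ⊕ N₂) := {t | v ∈ Sum.elim b₁ b₂ t}
    let f₁ : T₁.induce {t | v ∈ b₁ t} →g T.induce A :=
      ⟨fun t => ⟨.inl t.1, t.2⟩, fun {a b} hab => Or.inl (by simpa using hab)⟩
    let f₂ : T₂.induce {t | v ∈ b₂ t} →g T.induce A :=
      ⟨fun t => ⟨.inr t.1, t.2⟩, fun {a b} hab => Or.inl (by simpa using hab)⟩
    have l : ∀ s t (hs : v ∈ b₁ s) (ht : v ∈ b₁ t),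
        (T.induce A).Reachable ⟨.inl s, hs⟩ ⟨.inl t, ht⟩ := fun s t hs ht =>
      ((hc₁ v (hb₁ s hs)).preconnected ⟨s, hs⟩ ⟨t, ht⟩).map f₁
    have r : ∀ s t (hs : v ∈ b₂ s) (ht : v ∈ b₂ t),
        (T.induce A).Reachable ⟨.inr s, hs⟩ ⟨.inr t, ht⟩ := fun s t hs ht =>
      ((hc₂ v (hb₂ s hs)).preconnected ⟨s, hs⟩ ⟨t, ht⟩).map f₂
    have lr : ∀ s t (hs : v ∈ b₁ s) (ht : v ∈ b₂ t),
        (T.induce A).Reachable ⟨.inl s, hs⟩ ⟨.inr t, ht⟩ := by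
      intro s t hs ht
      have hv₁ : v ∈ b₁ r₁ := hr₁ (hY₁ ⟨hb₁ s hs, hb₂ t ht⟩)
      have hv₂ : v ∈ b₂ r₂ := hr₂ (hY₂ ⟨hb₁ s hs, hb₂ t ht⟩)
      refine ((l s r₁ hs hv₁).trans (Adj.reachable ?_)).trans (r r₂ t hv₂ ht)
      exact Or.inr (by simp [edge_adj])
    have hne : Nonempty A := by
      rcases hv with hv | hv
      · obtain ⟨⟨t, ht⟩⟩ := (hc₁ v hv).nonempty
        exact ⟨⟨.inl t, ht⟩⟩
      · obtain ⟨⟨t, ht⟩⟩ := (hc₂ v hv).nonempty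
        exact ⟨⟨.inr t, ht⟩⟩
    refine ⟨?_⟩
    rintro ⟨s | s, hs⟩ ⟨t | t, ht⟩
    · exact l s t hs ht
    · exact lr s t hs ht
    · exact (lr t s ht hs).symm
    · exact r s t hs ht
  · have key₁ : ∀ a ∈ U₁, ∀ b ∈ U₁, G.Adj a b →
        ∃ t, a ∈ Sum.elim b₁ b₂ t ∧ b ∈ Sum.elim b₁ b₂ t := fun a ha b hb hab =>
      let ⟨t, h⟩ := he₁ a ha b hb hab
      ⟨.inl t, h⟩
    have key₂ : ∀ a ∈ U₂, ∀ b ∈ U₂, G.Adj a b →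
        ∃ t, a ∈ Sum.elim b₁ b₂ t ∧ b ∈ Sum.elim b₁ b₂ t := fun a ha b hb hab =>
      let ⟨t, h⟩ := he₂ a ha b hb hab
      ⟨.inr t, h⟩
    rintro a (ha | ha) b (hb | hb) hab
    · exact key₁ a ha b hb hab
    · rcases hadj a ha b hb hab with h | h
      · exact key₂ a h b hb hab
      · exact key₁ a ha b h hab
    · rcases hadj b hb a ha hab.symm with h | h
      · exact key₂ a ha b h hab
      · exact key₁ a h b hb hab
    · exact key₂ a ha b hb hab

theorem RootedDecomposable.treeIndepNum_le [Finite V] {k : ℕ} {Y : Set V}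
    (h : G.RootedDecomposable k Set.univ Y) : G.treeIndepNum ≤ k := by
  obtain ⟨N, hN, T, b, r, ht, -, -, ha, hc, he⟩ := h
  let D : TreeDecomposition G :=
    { Node := N
      fintypeNode := Fintype.ofFinite N
      tree := T
      isTree := ht
      bag := b
      connected_bags := fun v => hc v trivial
      exists_bag_of_adj := fun a b hab => he a trivial b trivial hab }
  refine (Nat.sInf_le ⟨D, rfl⟩ : G.treeIndepNum ≤ D.indepNum).trans ?_
  exact Finset.sup_le fun t _ => (ha t).indepNum_induce_le

end SimpleGraph

/-! ### Connected sets, components and recursive splitting. -/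

namespace SimpleGraph

variable {V : Type u} (G : SimpleGraph V)

/-- `E` is nonempty and every partition of `E` into two nonempty parts is crossed by an edge. -/
def CutConnected (E : Set V) : Prop :=
  E.Nonempty ∧ ∀ A ⊆ E, A.Nonempty → (E \ A).Nonempty → ∃ a ∈ A, ∃ b ∈ E \ A, G.Adj a b

/-- `E` is a connected component of the subgraph induced by `W`. -/
def IsPart (E W : Set V) : Prop :=
  G.CutConnected E ∧ E ⊆ W ∧ ∀ e ∈ E, ∀ w ∈ W, G.Adj e w → w ∈ E

/-- The vertices outside `C` and `X` that have a neighbour in `C`. -/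
def outerNbhd (X C : Set V) : Set V :=
  {v | v ∉ C ∧ v ∉ X ∧ ∃ c ∈ C, G.Adj v c}

/-- No vertex of `A` lies in `B` or has a neighbour in `B`. -/
def Anticomplete (A B : Set V) : Prop :=
  ∀ a ∈ A, a ∉ B ∧ ∀ b ∈ B, ¬ G.Adj a b

/-- `D` can be decomposed recursively: a set `Z ⊆ D` forms a bag together with the outer
neighbourhood of `D`, and all components of `D \ Z` can be decomposed. The vertices of `X` are
ignored. -/
inductive Splittable (k : ℕ) (X : Set V) : Set V → Prop
  | intro (D Z : Set V) (hZ : Z ⊆ D) (hk : G.IndepLE k (G.outerNbhd X D ∪ Z))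
      (h : ∀ E, G.IsPart E (D \ Z) → Splittable k X E) : Splittable k X D

variable {G}

theorem Anticomplete.symm {A B : Set V} (h : G.Anticomplete A B) : G.Anticomplete B A :=
  fun b hb => ⟨fun ha => (h b ha).1 hb, fun a ha hab => (h a ha).2 b hb hab.symm⟩

theorem CutConnected.singleton (v : V) : G.CutConnected {v} := by
  refine ⟨⟨v, rfl⟩, fun A hA ⟨a, ha⟩ ⟨b, hb, hbA⟩ => ?_⟩
  obtain rfl : a = v := hA ha
  obtain rfl : b = a := hb
  exact absurd ha hbA

theorem CutConnected.insert_of_adj {E : Set V} (h : G.CutConnected E) {t e : V} (he : e ∈ E)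
    (hte : G.Adj t e) : G.CutConnected (insert t E) := by
  classical
  refine ⟨⟨t, Or.inl rfl⟩, fun A hA ⟨a, ha⟩ ⟨b, hb, hbA⟩ => ?_⟩
  by_cases hAE : (A ∩ E).Nonempty ∧ (E \ A).Nonempty
  · obtain ⟨x, hx, y, hy, hxy⟩ := h.2 (A ∩ E) Set.inter_subset_right hAE.1
      (by rw [Set.sdiff_inter_self_eq_sdiff]; exact hAE.2)
    exact ⟨x, hx.1, y, ⟨Or.inr hy.1, fun hyA => hy.2 ⟨hyA, hy.1⟩⟩, hxy⟩
  by_cases heA : e ∈ A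
  · have hEA : E ⊆ A := by
      intro x hx
      by_contra hxA
      exact hAE ⟨⟨e, heA, he⟩, ⟨x, hx, hxA⟩⟩
    have hbt : b = t := hb.resolve_right fun hbE => hbA (hEA hbE)
    exact ⟨e, heA, t, ⟨Or.inl rfl, hbt ▸ hbA⟩, hte.symm⟩
  · have hat : a = t := (hA ha).resolve_right fun haE => hAE ⟨⟨a, ha, haE⟩, ⟨e, he, heA⟩⟩
    exact ⟨t, hat ▸ ha, e, ⟨Or.inr he, heA⟩, hte⟩

/-- A vertex together with some of its neighbours is connected. -/
theorem CutConnected.star {v : V} {I : Finset V} (h : ∀ i ∈ I, G.Adj v i) :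
    G.CutConnected (insert v (I : Set V)) := by
  classical
  induction I using Finset.induction_on with
  | empty => simpa using CutConnected.singleton v
  | insert a I ha ih =>
    have := (ih fun i hi => h i (Finset.mem_insert_of_mem hi)).insert_of_adj (Or.inl rfl)
      (h a (Finset.mem_insert_self _ _)).symm
    rwa [Set.insert_comm, ← Finset.coe_insert] at this

/-- A vertex with a neighbour and a non-neighbour in a connected set splits an edge of it. -/
theorem CutConnected.exists_edge_split {E : Set V} (h : G.CutConnected E) {t a b : V}
    (ha : a ∈ E) (hta : G.Adj t a) (hb : b ∈ E) (htb : ¬ G.Adj t b) :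
    ∃ x ∈ E, ∃ y ∈ E, G.Adj x y ∧ G.Adj t x ∧ ¬ G.Adj t y := by
  obtain ⟨x, hx, y, hy, hxy⟩ := h.2 {e ∈ E | G.Adj t e} (fun _ h => h.1) ⟨a, ha, hta⟩
    ⟨b, hb, fun h => htb h.2⟩
  exact ⟨x, hx.1, y, hy.1, hxy, hx.2, fun h => hy.2 ⟨hy.1, h⟩⟩

/-- A proper connected subset of a connected set has a neighbour in it. -/
theorem CutConnected.exists_adj_of_subset {C E : Set V} (hC : G.CutConnected C) (hEC : E ⊆ C)
    (hE : E.Nonempty) (hne : (C \ E).Nonempty) : ∃ z ∈ C, z ∉ E ∧ ∃ e ∈ E, G.Adj z e := by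
  obtain ⟨e, he, z, hz, hez⟩ := hC.2 E hEC hE hne
  exact ⟨z, hz.1, hz.2, e, he, hez.symm⟩

theorem exists_isPart [Finite V] {W : Set V} {x : V} (hx : x ∈ W) : ∃ E, G.IsPart E W ∧ x ∈ E := by
  classical
  obtain ⟨E, ⟨hE, hEW, hxE⟩, hmax⟩ := Set.Finite.exists_maximalFor (fun E : Set V => E)
    {E : Set V | G.CutConnected E ∧ E ⊆ W ∧ x ∈ E} (Set.toFinite _)
    ⟨{x}, CutConnected.singleton x, Set.singleton_subset_iff.2 hx, rfl⟩
  refine ⟨E, ⟨hE, hEW, fun e he w hw hew => ?_⟩, hxE⟩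
  exact hmax (j := insert w E) ⟨hE.insert_of_adj he hew.symm, Set.insert_subset hw hEW, Or.inr hxE⟩
    (Set.subset_insert _ _) (Or.inl rfl)

theorem IsPart.subset_of_mem {E F W : Set V} (hE : G.IsPart E W) (hF : G.IsPart F W) {x : V}
    (hxE : x ∈ E) (hxF : x ∈ F) : E ⊆ F := by
  intro y hy
  by_contra hyF
  obtain ⟨a, ha, b, hb, hab⟩ := hE.1.2 (E ∩ F) Set.inter_subset_left ⟨x, hxE, hxF⟩
    ⟨y, hy, fun h => hyF h.2⟩
  exact hb.2 ⟨hb.1, hF.2.2 a ha.2 b (hE.2.1 hb.1) hab⟩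

theorem IsPart.eq_of_mem {E F W : Set V} (hE : G.IsPart E W) (hF : G.IsPart F W) {x : V}
    (hxE : x ∈ E) (hxF : x ∈ F) : E = F :=
  (hE.subset_of_mem hF hxE hxF).antisymm (hF.subset_of_mem hE hxF hxE)

theorem IsPart.anticomplete {E F W : Set V} (hE : G.IsPart E W) (hF : G.IsPart F W) (hne : E ≠ F) :
    G.Anticomplete E F :=
  fun x hx => ⟨fun hxF => hne (hE.eq_of_mem hF hx hxF), fun y hy hxy =>
    hne (hE.eq_of_mem hF (hE.2.2 x hx y (hF.2.1 hy) hxy) hy)⟩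

theorem IsPart.outerNbhd_subset {X D Z E : Set V} (hE : G.IsPart E (D \ Z)) :
    G.outerNbhd X E ⊆ G.outerNbhd X D ∪ Z := by
  rintro v ⟨hvE, hvX, e, he, hve⟩
  by_cases hvD : v ∈ D
  · right
    by_contra hvZ
    exact hvE (hE.2.2 e he v ⟨hvD, hvZ⟩ hve.symm)
  · exact Or.inl ⟨hvD, hvX, e, (hE.2.1 he).1, hve⟩

/-- The root bag is Ω. The decomposition of each component E has a root bag containing the outer
neighbourhood of E, which lies in Ω, so the components can be glued to the same root one at a time.
-/
theorem Splittable.rootedDecomposable [Finite V] {k : ℕ} {D : Set V} (h : G.Splittable k ∅ D) :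
    G.RootedDecomposable k (D ∪ G.outerNbhd ∅ D) (G.outerNbhd ∅ D) := by
  classical
  induction h with
  | intro D Z hZ hk h ih =>
    set Ω := G.outerNbhd ∅ D ∪ Z with hΩ
    have hdisj : ∀ E, G.IsPart E (D \ Z) → ∀ x ∈ E, x ∉ Ω := by
      rintro E hE x hx (h | h)
      · exact h.1 (hE.2.1 hx).1
      · exact (hE.2.1 hx).2 h
    have key : ∀ F ⊆ {E | G.IsPart E (D \ Z)},
        G.RootedDecomposable k (Ω ∪ ⋃ E ∈ F, (E ∪ G.outerNbhd ∅ E)) Ω := by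
      intro F hF
      induction F, Set.toFinite F using Set.Finite.induction_on with
      | empty => simpa using RootedDecomposable.of_indepLE hk
      | @insert E F hEF _ ihF =>
        have hE : G.IsPart E (D \ Z) := hF (Set.mem_insert _ _)
        have hF' : F ⊆ {E | G.IsPart E (D \ Z)} := (Set.subset_insert _ _).trans hF
        have hout : ∀ x ∈ E, x ∉ Ω ∪ ⋃ E ∈ F, (E ∪ G.outerNbhd ∅ E) := by
          rintro x hx (h | h)
          · exact hdisj E hE x hx h
          · obtain ⟨E', hE', h | h⟩ := Set.mem_iUnion₂.1 h
            · exact hEF (hE.eq_of_mem (hF' hE') hx h ▸ hE')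
            · exact hdisj E hE x hx ((hF' hE').outerNbhd_subset h)
        have := (ihF hF').union (ih E hE) (Y₁ := Ω) ?_ ?_ ?_
        · rwa [Set.biUnion_insert, Set.union_left_comm, Set.union_comm]
        · rintro x ⟨hx₁, hx₂ | hx₂⟩
          · exact absurd hx₁ (hout x hx₂)
          · exact hE.outerNbhd_subset hx₂
        · rintro x ⟨hx₁, hx₂ | hx₂⟩
          · exact absurd hx₁ (hout x hx₂)
          · exact hx₂
        · rintro a ha b (hb | hb) hab
          · left
            by_cases haE : a ∈ E
            · exact Or.inl haE
            · exact Or.inr ⟨haE, id, b, hb, hab⟩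
          · exact Or.inr (Or.inl (hE.outerNbhd_subset hb))
    obtain ⟨N, hN, T, b, r, ht, hr, hb⟩ := key _ subset_rfl
    have hU : (Ω ∪ ⋃ E ∈ {E | G.IsPart E (D \ Z)}, (E ∪ G.outerNbhd ∅ E)) =
        D ∪ G.outerNbhd ∅ D := by
      apply Set.Subset.antisymm
      · refine Set.union_subset (Set.union_subset Set.subset_union_right
          (hZ.trans Set.subset_union_left)) (Set.iUnion₂_subset fun E hE => Set.union_subset
            (fun x hx => Or.inl (hE.2.1 hx).1) (hE.outerNbhd_subset.trans
              (Set.union_subset Set.subset_union_right (hZ.trans Set.subset_union_left))))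
      · rintro x (hx | hx)
        · by_cases hxZ : x ∈ Z
          · exact Or.inl (Or.inr hxZ)
          · obtain ⟨E, hE, hxE⟩ := exists_isPart (G := G) (W := D \ Z) ⟨hx, hxZ⟩
            exact Or.inr (Set.mem_iUnion₂.2 ⟨E, hE, Or.inl hxE⟩)
        · exact Or.inl (Or.inl hx)
    rw [hU] at hb
    exact ⟨N, hN, T, b, r, ht, Set.subset_union_left.trans hr, hb⟩

/-- The ignored vertices can be added to all bags. -/
theorem Splittable.of_ignored {k l : ℕ} {X D : Set V} (h : G.Splittable k X D)
    (hX : G.IndepLE l X) : G.Splittable (k + l) ∅ D := by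
  induction h with
  | intro D Z hZ hk h ih =>
    refine .intro D Z hZ ((hk.union hX).mono ?_ le_rfl) ih
    rintro v (⟨hvD, -, hv⟩ | hv)
    · by_cases hvX : v ∈ X
      · exact Or.inr hvX
      · exact Or.inl (Or.inl ⟨hvD, hvX, hv⟩)
    · exact Or.inl (Or.inr hv)

end SimpleGraph

/-! ### Anchors and boundaries in P₅-free graphs. -/

namespace SimpleGraph

variable {V : Type u} (G : SimpleGraph V)

/-- There is no induced path on five vertices. -/
def NoInducedP5 : Prop :=
  ∀ ⦃a b c d e : V⦄, G.Adj a b → G.Adj b c → G.Adj c d → G.Adj d e → ¬ G.Adj a c → ¬ G.Adj a d →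
    ¬ G.Adj a e → ¬ G.Adj b d → ¬ G.Adj b e → ¬ G.Adj c e → False

/-- Independent sets of vertices outside `C` and `X` that have both neighbours and non-neighbours
in `C` attach to a common connected set with the property `P`, anticomplete to `C`. -/
def Anchored (P : Set V → Prop) (X C : Set V) : Prop :=
  ∀ M ⊆ G.outerNbhd X C, G.IsIndepSet M → (∀ m ∈ M, ∃ c ∈ C, ¬ G.Adj m c) → M.Nonempty →
    ∃ B, G.CutConnected B ∧ P B ∧ G.Anticomplete B C ∧ ∀ m ∈ M, ∃ b ∈ B, G.Adj m b

variable {G}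

/-- A vertex cannot split edges of two anticomplete connected sets. -/
theorem NoInducedP5.adj_of_anticomplete (hP : G.NoInducedP5) {B C : Set V}
    (hB : G.CutConnected B) (hC : G.CutConnected C) (hBC : G.Anticomplete B C) {m c c' b b' : V}
    (hc : c ∈ C) (hmc : G.Adj m c) (hc' : c' ∈ C) (hmc' : ¬ G.Adj m c')
    (hb : b ∈ B) (hmb : G.Adj m b) (hb' : b' ∈ B) : G.Adj m b' := by
  by_contra hmb'
  -- Edges split by `m` on both sides give the induced path `q p m x y`.
  obtain ⟨x, hx, y, hy, hxy, hmx, hmy⟩ := hC.exists_edge_split hc hmc hc' hmc'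
  obtain ⟨p, hp, q, hq, hpq, hmp, hmq⟩ := hB.exists_edge_split hb hmb hb' hmb'
  exact hP hpq.symm hmp.symm hmx hxy (fun h => hmq h.symm) ((hBC q hq).2 x hx) ((hBC q hq).2 y hy)
    ((hBC p hp).2 x hx) ((hBC p hp).2 y hy) hmy

/-- In a `P₅`-free graph, anchored vertices are complete to their anchor. -/
theorem Anchored.exists_complete {P : Set V → Prop} {X C M : Set V} (h : G.Anchored P X C)
    (hP : G.NoInducedP5) (hC : G.CutConnected C) (hM : M ⊆ G.outerNbhd X C) (hi : G.IsIndepSet M)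
    (hm : ∀ m ∈ M, ∃ c ∈ C, ¬ G.Adj m c) (hne : M.Nonempty) :
    ∃ B, G.CutConnected B ∧ P B ∧ G.Anticomplete B C ∧ ∀ m ∈ M, ∀ b ∈ B, G.Adj m b := by
  obtain ⟨B, hB, hPB, hBC, hMB⟩ := h M hM hi hm hne
  refine ⟨B, hB, hPB, hBC, fun m hmM b hb => ?_⟩
  obtain ⟨c, hc, hmc⟩ := (hM hmM).2.2
  obtain ⟨c', hc', hmc'⟩ := hm m hmM
  obtain ⟨b', hb', hmb'⟩ := hMB m hmM
  exact hP.adj_of_anticomplete hB hC hBC hc hmc hc' hmc' hb' hmb' hb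

/-- An independent set in the outer neighbourhood of a part of `C` that stays outside `C` keeps
its anchor. -/
theorem Anchored.of_subset {P : Set V → Prop} {X C D M : Set V} (h : G.Anchored P X C)
    (hDC : D ⊆ C) (hM : M ⊆ G.outerNbhd X C) (hi : G.IsIndepSet M)
    (hm : ∀ m ∈ M, ∃ d ∈ D, ¬ G.Adj m d) (hne : M.Nonempty) :
    ∃ B, G.CutConnected B ∧ P B ∧ G.Anticomplete B D ∧ ∀ m ∈ M, ∃ b ∈ B, G.Adj m b := by
  obtain ⟨B, hB, hPB, hBC, hMB⟩ := h M hM hi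
    (fun m hmM => let ⟨d, hd, hmd⟩ := hm m hmM; ⟨d, hDC hd, hmd⟩) hne
  exact ⟨B, hB, hPB, fun b hb => ⟨fun hbD => (hBC b hb).1 (hDC hbD),
    fun d hd => (hBC b hb).2 d (hDC hd)⟩, hMB⟩

theorem isPart_diff_boundary {C E : Set V} (hE : G.CutConnected E) (hEC : E ⊆ C) :
    G.IsPart E (C \ {z | z ∈ C ∧ z ∉ E ∧ ∃ e ∈ E, G.Adj z e}) := by
  refine ⟨hE, fun e he => ⟨hEC he, fun h => h.2.1 he⟩, fun e he w hw hew => ?_⟩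
  by_contra hwE
  exact hw.2 ⟨hw.1, hwE, e, he, hew.symm⟩

/-- If some connected `P`-set in `C` misses a vertex of the outer neighbourhood of `C`, then a
largest such set `E` has a boundary `Z` in `C` that is complete to `E` and to the missed vertices,
and all components of `C \ Z` are anchored. -/
theorem Anchored.exists_boundary_of_not_full [Finite V] {P : Set V → Prop}
    (hmono : ∀ ⦃A B : Set V⦄, A ⊆ B → P A → P B) {X C : Set V} (h : G.Anchored P X C)
    (hP : G.NoInducedP5) (hC : G.CutConnected C)
    (hex : ∃ E ⊆ C, G.CutConnected E ∧ P E ∧ ∃ s ∈ G.outerNbhd X C, ∀ e ∈ E, ¬ G.Adj s e) :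
    ∃ E ⊆ C, ∃ Z ⊆ C, G.CutConnected E ∧ P E ∧ Z.Nonempty ∧ (∀ z ∈ Z, ∀ e ∈ E, G.Adj z e) ∧
      (∀ z ∈ Z, ∀ s ∈ G.outerNbhd X C, (∀ e ∈ E, ¬ G.Adj s e) → G.Adj z s) ∧
      ∀ D, G.IsPart D (C \ Z) → G.Anchored P X D := by
  obtain ⟨E, ⟨hEC, hE, hPE, s, hs, hsE⟩, hmax⟩ := Set.Finite.exists_maximalFor (fun E : Set V => E)
    {E : Set V | E ⊆ C ∧ G.CutConnected E ∧ P E ∧ ∃ s ∈ G.outerNbhd X C, ∀ e ∈ E, ¬ G.Adj s e}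
    (Set.toFinite _) hex
  set Z : Set V := {z | z ∈ C ∧ z ∉ E ∧ ∃ e ∈ E, G.Adj z e} with hZ
  have hZs : ∀ z ∈ Z, ∀ s ∈ G.outerNbhd X C, (∀ e ∈ E, ¬ G.Adj s e) → G.Adj z s := by
    rintro z ⟨hzC, hzE, e, he, hze⟩ s hs hsE
    by_contra hzs
    -- Otherwise `insert z E` would still miss `s`, against the maximality of `E`.
    refine hzE (hmax (j := insert z E) ⟨Set.insert_subset hzC hEC, hE.insert_of_adj he hze,
      hmono (Set.subset_insert _ _) hPE, s, hs, ?_⟩ (Set.subset_insert _ _) (Or.inl rfl))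
    rintro x (rfl | hx)
    · exact fun h => hzs h.symm
    · exact hsE x hx
  obtain ⟨e₀, he₀⟩ := hE.1
  obtain ⟨B, -, -, hBC, hsB⟩ := h {s} (by simpa using hs) (by simp [IsIndepSet])
    (by simpa using ⟨e₀, hEC he₀, hsE e₀ he₀⟩) ⟨s, rfl⟩
  obtain ⟨b, hb, hsb⟩ := hsB s rfl
  -- An edge `x y` of `E` split by `z` would give the induced path `y x z s b`, with `b` in the
  -- anchor of `s`.
  have hZE : ∀ z ∈ Z, ∀ e ∈ E, G.Adj z e := by
    intro z hz e' he'
    by_contra hze'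
    obtain ⟨e, he, hze⟩ := hz.2.2
    obtain ⟨x, hx, y, hy, hxy, hzx, hzy⟩ := hE.exists_edge_split he hze he' hze'
    exact hP hxy.symm hzx.symm (hZs z hz s hs hsE) hsb (fun h => hzy h.symm)
      (fun h => hsE y hy h.symm) (fun h => (hBC b hb).2 y (hEC hy) h.symm)
      (fun h => hsE x hx h.symm) (fun h => (hBC b hb).2 x (hEC hx) h.symm)
      (fun h => (hBC b hb).2 z hz.1 h.symm)
  have hZne : Z.Nonempty := by
    obtain ⟨c, hc, hsc⟩ := hs.2.2
    obtain ⟨z, hz⟩ := hC.exists_adj_of_subset hEC hE.1 ⟨c, hc, fun hcE => hsE c hcE hsc⟩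
    exact ⟨z, hz⟩
  refine ⟨E, hEC, Z, fun z hz => hz.1, hE, hPE, hZne, hZE, hZs, fun D hD M hM hi hm hne => ?_⟩
  have hDC : D ⊆ C := fun d hd => (hD.2.1 hd).1
  have hM' : M ⊆ G.outerNbhd X C ∪ Z := hM.trans hD.outerNbhd_subset
  by_cases hMZ : ∃ z ∈ M, z ∈ Z
  · obtain ⟨z, hzM, hzZ⟩ := hMZ
    have hDE : E ≠ D := by
      rintro rfl
      obtain ⟨d, hd, hzd⟩ := hm z hzM
      exact hzd (hZE z hzZ d hd)
    -- `E` is the new anchor: a vertex of `M` missing `E` would be adjacent to `z`, although both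
    -- lie in the independent set `M`.
    refine ⟨E, hE, hPE, (isPart_diff_boundary hE hEC).anticomplete hD hDE, fun m hmM => ?_⟩
    rcases hM' hmM with hmS | hmZ
    · by_contra! hmE
      exact hi.not_adj hzM hmM (hZs z hzZ m hmS hmE)
    · exact hmZ.2.2
  · exact h.of_subset hDC (fun m hmM => (hM' hmM).resolve_right fun hmZ => hMZ ⟨m, hmM, hmZ⟩)
      hi hm hne

/-- If all connected `P`-sets in `C` see the whole outer neighbourhood of `C` and two of them are
anticomplete, then the boundary of a largest one is seen by everything anticomplete to it, and all
components of the rest are anchored. -/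
theorem exists_boundary_of_full [Finite V] {P : Set V → Prop}
    (hmono : ∀ ⦃A B : Set V⦄, A ⊆ B → P A → P B) {X C : Set V} (hC : G.CutConnected C)
    (hfull : ∀ E ⊆ C, G.CutConnected E → P E → ∀ s ∈ G.outerNbhd X C, ∃ e ∈ E, G.Adj s e)
    (hex : ∃ E ⊆ C, G.CutConnected E ∧ P E ∧
      ∃ F ⊆ C, G.CutConnected F ∧ P F ∧ G.Anticomplete E F) :
    ∃ E ⊆ C, ∃ Z ⊆ C, G.CutConnected E ∧ P E ∧ Z.Nonempty ∧
      (∃ F ⊆ C, G.CutConnected F ∧ P F ∧ G.Anticomplete E F) ∧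
      (∀ z ∈ G.outerNbhd X C ∪ Z, ∃ e ∈ E, G.Adj z e) ∧
      (∀ F ⊆ C, G.CutConnected F → P F → G.Anticomplete E F →
        ∀ z ∈ G.outerNbhd X C ∪ Z, ∃ f ∈ F, G.Adj z f) ∧
      ∀ D, G.IsPart D (C \ Z) → G.Anchored P X D := by
  obtain ⟨E, ⟨hEC, hE, hPE, F, hFC, hF, hPF, hEF⟩, hmax⟩ :=
    Set.Finite.exists_maximalFor (fun E : Set V => E)
      {E : Set V | E ⊆ C ∧ G.CutConnected E ∧ P E ∧
        ∃ F ⊆ C, G.CutConnected F ∧ P F ∧ G.Anticomplete E F} (Set.toFinite _) hex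
  set Z : Set V := {z | z ∈ C ∧ z ∉ E ∧ ∃ e ∈ E, G.Adj z e} with hZ
  have hZne : Z.Nonempty := by
    obtain ⟨f, hf⟩ := hF.1
    obtain ⟨z, hz⟩ := hC.exists_adj_of_subset hEC hE.1 ⟨f, hFC hf, (hEF.symm f hf).1⟩
    exact ⟨z, hz⟩
  have hSE : ∀ z ∈ G.outerNbhd X C ∪ Z, ∃ e ∈ E, G.Adj z e := by
    rintro z (hz | hz)
    · exact hfull E hEC hE hPE z hz
    · exact hz.2.2
  have hSF : ∀ F ⊆ C, G.CutConnected F → P F → G.Anticomplete E F →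
      ∀ z ∈ G.outerNbhd X C ∪ Z, ∃ f ∈ F, G.Adj z f := by
    rintro F hFC hF hPF hEF z (hz | ⟨hzC, hzE, e, he, hze⟩)
    · exact hfull F hFC hF hPF z hz
    · by_contra! hzF
      refine hzE (hmax (j := insert z E) ⟨Set.insert_subset hzC hEC, hE.insert_of_adj he hze,
        hmono (Set.subset_insert _ _) hPE, F, hFC, hF, hPF, ?_⟩ (Set.subset_insert _ _)
        (Or.inl rfl))
      rintro x (rfl | hx)
      · exact ⟨fun hxF => (hEF e he).2 x hxF hze.symm, hzF⟩
      · exact hEF x hx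
  refine ⟨E, hEC, Z, fun z hz => hz.1, hE, hPE, hZne, ⟨F, hFC, hF, hPF, hEF⟩, hSE, hSF,
    fun D hD M hM _ _ _ => ?_⟩
  -- Everything in the bag sees both `E` and `F`, so whichever lies away from `D` is the anchor.
  by_cases hDE : E = D
  · subst hDE
    exact ⟨F, hF, hPF, hEF.symm, fun m hm => hSF F hFC hF hPF hEF m (hD.outerNbhd_subset (hM hm))⟩
  · exact ⟨E, hE, hPE, (isPart_diff_boundary hE hEC).anticomplete hD hDE,
      fun m hm => hSE m (hD.outerNbhd_subset (hM hm))⟩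

theorem IsPart.ncard_lt [Finite V] {C Z D : Set V} (hD : G.IsPart D (C \ Z)) (hZC : Z ⊆ C)
    (hZ : Z.Nonempty) : D.ncard < C.ncard := by
  obtain ⟨z, hz⟩ := hZ
  exact Set.ncard_lt_ncard ⟨fun d hd => (hD.2.1 hd).1, fun h => (hD.2.1 (h (hZC hz))).2 hz⟩

/-! ### The recursion when neighbourhoods have small independence number. -/

/-- If all vertices of an anchored connected set `C` have neighbourhoods of small independence
number, then `C` can be decomposed. -/
theorem Anchored.splittable_of_indepLE_neighborSet [Finite V] (hP : G.NoInducedP5) {k : ℕ}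
    (hk : 1 ≤ k) {X : Set V} {C : Set V} (hC : G.CutConnected C)
    (h : G.Anchored (fun _ => True) X C) (hS : G.IndepLE k (G.outerNbhd X C))
    (hl : ∀ c ∈ C, G.IndepLE k (G.neighborSet c)) : G.Splittable k X C := by
  classical
  induction hn : C.ncard using Nat.strong_induction_on generalizing C with
  | _ n ih =>
  subst hn
  have step : ∀ Z ⊆ C, Z.Nonempty → G.IndepLE k (G.outerNbhd X C ∪ Z) →
      (∀ D, G.IsPart D (C \ Z) → G.Anchored (fun _ => True) X D) → G.Splittable k X C := by
    intro Z hZC hZ hZk hZD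
    refine .intro C Z hZC hZk fun D hD => ih _ (hD.ncard_lt hZC hZ) hD.1 (hZD D hD)
      (hZk.mono hD.outerNbhd_subset le_rfl) (fun d hd => hl d (hD.2.1 hd).1) rfl
  by_cases hex : ∃ E ⊆ C, G.CutConnected E ∧ True ∧ ∃ s ∈ G.outerNbhd X C, ∀ e ∈ E, ¬ G.Adj s e
  · obtain ⟨E, hEC, Z, hZC, hE, -, hZne, hZE, hZs, hD⟩ :=
      h.exists_boundary_of_not_full (fun _ _ _ h => h) hP hC hex
    refine step Z hZC hZne (fun M hM hi => ?_) hD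
    by_cases hMZ : ∃ z ∈ M, z ∈ Z
    · obtain ⟨z, hzM, hzZ⟩ := hMZ
      have hzC : z ∈ C := hZC hzZ
      -- `M` is placed in the neighbourhood of a single vertex, so that the bound `k` does not grow.
      -- Only the vertices in `R` below can fail to be complete to `E`.
      suffices ∃ e ∈ E, ∀ m ∈ M, G.Adj e m by
        obtain ⟨e, he, hem⟩ := this
        exact hl e (hEC he) M (fun m hm => hem m hm) hi
      set R : Set V := {m | m ∈ M ∧ m ∉ Z ∧ ∃ c ∈ C, ¬ G.Adj m c} with hR
      have hRS : R ⊆ G.outerNbhd X C := fun m hm => (hM hm.1).resolve_right hm.2.1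
      have hcase : ∀ e ∈ E, (∀ m ∈ R, G.Adj e m) → ∀ m ∈ M, G.Adj e m := by
        intro e he heR m hm
        by_cases hmZ : m ∈ Z
        · exact (hZE m hmZ e he).symm
        · by_contra hem
          exact hem (heR m ⟨hm, hmZ, e, hEC he, fun h => hem h.symm⟩)
      rcases R.eq_empty_or_nonempty with hR0 | ⟨v, hv⟩
      · obtain ⟨e, he⟩ := hE.1
        exact ⟨e, he, hcase e he (by simp [hR0])⟩
      · obtain ⟨e, he, hve⟩ : ∃ e ∈ E, G.Adj v e := by
          by_contra! hvE
          exact hi.not_adj hzM hv.1 (hZs z hzZ v (hRS hv) hvE)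
        refine ⟨e, he, hcase e he fun m hm => ?_⟩
        by_contra hem
        -- A vertex `b` of the common anchor of `R` gives the induced path `m b v e z`.
        obtain ⟨B, hB, -, hBC, hRB⟩ := h.exists_complete hP hC hRS
          (hi.subset fun m hm => hm.1) (fun m hm => hm.2.2) ⟨v, hv⟩
        obtain ⟨b, hb⟩ := hB.1
        exact hP (hRB m hm b hb) (hRB v hv b hb).symm hve (hZE z hzZ e he).symm
          (hi.not_adj hm.1 hv.1) (fun h => hem h.symm) (hi.not_adj hm.1 hzM)
          ((hBC b hb).2 e (hEC he)) ((hBC b hb).2 z hzC) (hi.not_adj hv.1 hzM)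
    · exact hS M (fun m hm => (hM hm).resolve_right fun hmZ => hMZ ⟨m, hm, hmZ⟩) hi
  push Not at hex
  have hfull : ∀ E ⊆ C, G.CutConnected E → True → ∀ s ∈ G.outerNbhd X C, ∃ e ∈ E, G.Adj s e :=
    fun E hEC hE _ s hs => hex E hEC hE trivial s hs
  by_cases hex2 : ∃ E ⊆ C, G.CutConnected E ∧ True ∧
      ∃ F ⊆ C, G.CutConnected F ∧ True ∧ G.Anticomplete E F
  · obtain ⟨E, hEC, Z, hZC, -, -, hZne, ⟨F, hFC, hF, -, hEF⟩, -, hSF, hD⟩ :=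
      exists_boundary_of_full (fun _ _ _ h => h) hC hfull hex2
    refine step Z hZC hZne (fun M hM hi => ?_) hD
    obtain ⟨f, hf⟩ := hF.1
    -- Singletons count as connected sets here, so the whole bag already sees the single vertex `f`.
    refine hl f (hFC hf) M (fun m hm => ?_) hi
    obtain ⟨g, rfl, hg⟩ := hSF {f} (by simpa using hFC hf) (.singleton f) trivial
      (fun e he => ⟨fun h => (hEF e he).1 (h ▸ hf), fun g hg => hg ▸ (hEF e he).2 f hf⟩) m (hM hm)
    exact hg.symm
  -- Applied to singletons, the failure of both cases makes `C` a clique complete to its outer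
  -- neighbourhood, so an independent set meeting `C` has one vertex.
  · refine step C subset_rfl hC.1 (fun M hM hi => ?_) fun D hD => ?_
    · by_cases hMC : ∃ c ∈ M, c ∈ C
      · obtain ⟨c, hcM, hcC⟩ := hMC
        refine le_trans (Finset.card_le_one.2 fun a ha b hb => ?_) hk
        suffices ∀ m ∈ M, m = c by rw [this a ha, this b hb]
        intro m hm
        by_contra hne
        rcases hM hm with hmS | hmC
        · obtain ⟨e, rfl, he⟩ := hfull {c} (by simpa using hcC) (.singleton c) trivial m hmS
          exact hi.not_adj hm hcM he
        · refine hex2 ⟨{m}, by simpa using hmC, .singleton m, trivial, {c}, by simpa using hcC,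
            .singleton c, trivial, ?_⟩
          rintro _ rfl
          refine ⟨hne, ?_⟩
          rintro _ rfl
          exact hi.not_adj hm hcM
      · exact hS M (fun m hm => (hM hm).resolve_right fun hmC => hMC ⟨m, hm, hmC⟩) hi
    · obtain ⟨d, hd⟩ := hD.1.1
      exact absurd (hD.2.1 hd) (by simp)

end SimpleGraph

/-! ### Large independent sets and the forbidden subgraphs. -/

namespace SimpleGraph

variable {V : Type u} (G : SimpleGraph V)

/-- No two independent sets with at least `ℓ` vertices are complete to each other. -/
def NoInducedBiclique (ℓ : ℕ) : Prop :=
  ∀ ⦃A B : Finset V⦄, G.IsIndepSet (A : Set V) → G.IsIndepSet (B : Set V) → ℓ ≤ A.card →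
    ℓ ≤ B.card → (∀ a ∈ A, ∀ b ∈ B, G.Adj a b) → False

/-- `s` contains an independent set with `ℓ` vertices. -/
def HasIndep (ℓ : ℕ) (s : Set V) : Prop :=
  ∃ M : Finset V, (M : Set V) ⊆ s ∧ G.IsIndepSet (M : Set V) ∧ ℓ ≤ M.card

variable {G} {ℓ : ℕ}

theorem HasIndep.mono {s t : Set V} (hst : s ⊆ t) (h : G.HasIndep ℓ s) : G.HasIndep ℓ t :=
  let ⟨M, hM, hi, hc⟩ := h
  ⟨M, hM.trans hst, hi, hc⟩

theorem IndepLE.of_not_hasIndep {s : Set V} (h : ¬ G.HasIndep ℓ s) : G.IndepLE ℓ s := by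
  intro M hM hi
  by_contra hc
  exact h ⟨M, hM, hi, by omega⟩

theorem NoInducedBiclique.card_lt (hK : G.NoInducedBiclique ℓ) {M : Finset V} {B : Set V}
    (hi : G.IsIndepSet (M : Set V)) (hB : G.HasIndep ℓ B) (h : ∀ m ∈ M, ∀ b ∈ B, G.Adj m b) :
    M.card < ℓ := by
  obtain ⟨N, hN, hNi, hNc⟩ := hB
  by_contra hc
  exact hK hi hNi (by omega) hNc fun m hm b hb => h m hm b (hN hb)

theorem noInducedP5_of_not_isIndContained (h : ¬ (pathGraph 5).IsIndContained G) :
    G.NoInducedP5 := by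
  intro a b c d e ab bc cd de nac nad nae nbd nbe nce
  have hac : a ≠ c := fun h => nad (h ▸ cd)
  have had : a ≠ d := fun h => nae (h ▸ de)
  have hae : a ≠ e := fun h => nbe (h ▸ ab.symm)
  have hbd : b ≠ d := fun h => nbe (h ▸ de)
  have hbe : b ≠ e := fun h => nae (h ▸ ab)
  have hce : c ≠ e := fun h => nbe (h ▸ bc)
  have e₁ := ab.ne
  have e₂ := bc.ne
  have e₃ := cd.ne
  have e₄ := de.ne
  refine h ⟨⟨⟨![a, b, c, d, e], ?_⟩, ?_⟩⟩
  · intro i j hij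
    fin_cases i <;> fin_cases j <;> simp_all [eq_comm]
  · intro i j
    change G.Adj (![a, b, c, d, e] i) (![a, b, c, d, e] j) ↔ _
    fin_cases i <;> fin_cases j <;> simp_all [pathGraph_adj, adj_comm]

theorem noInducedBiclique_of_not_isIndContained
    (h : ¬ (completeBipartiteGraph (Fin ℓ) (Fin ℓ)).IsIndContained G) :
    G.NoInducedBiclique ℓ := by
  intro A B hA hB hAc hBc hAB
  obtain ⟨f⟩ : Nonempty (Fin ℓ ↪ A) := Function.Embedding.nonempty_of_card_le (by simpa using hAc)
  obtain ⟨g⟩ : Nonempty (Fin ℓ ↪ B) := Function.Embedding.nonempty_of_card_le (by simpa using hBc)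
  refine h ⟨⟨⟨Sum.elim (fun i => (f i : V)) (fun i => (g i : V)), ?_⟩, ?_⟩⟩
  · refine Function.Injective.sumElim (Subtype.val_injective.comp f.injective)
      (Subtype.val_injective.comp g.injective) fun i j => (hAB _ (f i).2 _ (g j).2).ne
  · rintro (i | i) (j | j)
    · simpa using hA.not_adj (f i).2 (f j).2
    · simpa using hAB _ (f i).2 _ (g j).2
    · simpa using (hAB _ (f j).2 _ (g i).2).symm
    · simpa using hB.not_adj (g i).2 (g j).2

/-! ### Vertices whose neighbourhoods have large independence number. -/

/-- In a `P₅`-free graph, the traces of independent vertices on an independent set in the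
neighbourhood of one of them are nested; so one of them is contained in all others. -/
theorem NoInducedP5.exists_minimal_trace (hP : G.NoInducedP5) {J W I : Finset V} {v : V}
    (hJ : G.IsIndepSet (J : Set V)) (hv : v ∈ J) (hI : G.IsIndepSet (I : Set V))
    (hIv : ∀ i ∈ I, G.Adj v i) (hWJ : W ⊆ J) (hW : W.Nonempty) :
    ∃ w ∈ W, ∀ j ∈ W, ∀ i ∈ I, G.Adj w i → G.Adj j i := by
  classical
  obtain ⟨w, hw, hmin⟩ := W.exists_min_image (fun j => (I.filter (G.Adj j)).card) hW
  refine ⟨w, hw, fun j hj i hi hwi => ?_⟩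
  by_contra hji
  have hsub : I.filter (G.Adj j) ⊂ I.filter (G.Adj w) := by
    refine ⟨fun k hk => ?_, fun hss => ?_⟩
    · simp only [Finset.mem_filter] at hk ⊢
      refine ⟨hk.1, ?_⟩
      by_contra hwk
      -- If neither trace contained the other, `w i v k j` would be an induced path.
      exact hP hwi (hIv i hi).symm (hIv k hk.1) hk.2.symm (hJ.not_adj (hWJ hw) hv) hwk
        (hJ.not_adj (hWJ hw) (hWJ hj)) (hI.not_adj hi hk.1) (fun h => hji h.symm)
        (hJ.not_adj hv (hWJ hj))
    · exact hji (Finset.mem_filter.1 (hss (Finset.mem_filter.2 ⟨hi, hwi⟩))).2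
  exact absurd (Finset.card_lt_card hsub) (not_lt.2 (hmin j hj))

/-- Let `J` be an independent set such that of any two of its vertices one has few private
neighbours. Then not all vertices of `J` have neighbourhoods of large independence number. -/
theorem NoInducedBiclique.card_lt_of_private (hK : G.NoInducedBiclique ℓ) (hP : G.NoInducedP5)
    {J : Finset V} (hJ : G.IsIndepSet (J : Set V))
    (hpair : ∀ v ∈ J, ∀ w ∈ J, G.HasIndep ℓ (G.neighborSet v \ G.neighborSet w) →
      ¬ G.HasIndep ℓ (G.neighborSet w \ G.neighborSet v))
    (hheavy : ∀ v ∈ J, ¬ G.IndepLE (3 * ℓ) (G.neighborSet v)) : J.card < ℓ := by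
  classical
  by_contra! hJc
  rcases J.eq_empty_or_nonempty with rfl | ⟨v₀, hv₀⟩
  · exact hK (A := ∅) (B := ∅) (by simp) (by simp) hJc hJc (by simp)
  have hbig : ∀ v ∈ J, ∃ I : Finset V, (∀ i ∈ I, G.Adj v i) ∧ G.IsIndepSet (I : Set V) ∧
      3 * ℓ < I.card := by
    intro v hv
    have := hheavy v hv
    simp only [IndepLE, not_forall, not_le] at this
    obtain ⟨I, hI, hi, hc⟩ := this
    exact ⟨I, fun i hiI => hI hiI, hi, hc⟩
  -- Extremal choice: `I` is complete to as many vertices of `J` as possible. The size 2ℓ is what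
  -- remains of more than 3ℓ neighbours after losing fewer than ℓ.
  let Q : ℕ → Prop := fun n => ∃ v ∈ J, ∃ I : Finset V, (∀ i ∈ I, G.Adj v i) ∧
    G.IsIndepSet (I : Set V) ∧ 2 * ℓ ≤ I.card ∧ n = (J.filter fun j => ∀ i ∈ I, G.Adj j i).card
  have hQ : ∃ n ≤ J.card, Q n := by
    obtain ⟨I, hI, hi, hc⟩ := hbig v₀ hv₀
    exact ⟨_, Finset.card_filter_le _ _, v₀, hv₀, I, hI, hi, by omega, rfl⟩
  obtain ⟨n, hn, hQn⟩ := hQ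
  have hmax : ∀ m, Q m → m ≤ Nat.findGreatest Q J.card := by
    rintro m hm
    refine Nat.le_findGreatest ?_ hm
    obtain ⟨_, _, _, _, _, _, rfl⟩ := hm
    exact Finset.card_filter_le _ _
  obtain ⟨v, hv, I, hIv, hI, hIc, hW⟩ := Nat.findGreatest_spec hn hQn
  set W := J.filter fun j => ∀ i ∈ I, G.Adj j i with hWdef
  rw [hW] at hmax
  have hvW : v ∈ W := Finset.mem_filter.2 ⟨hv, hIv⟩
  have hWJ : W ⊆ J := Finset.filter_subset _ _
  obtain ⟨x, hx, hxmin⟩ := hP.exists_minimal_trace hJ hv hI hIv subset_rfl ⟨v, hv⟩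
  -- The minimal trace is complete to all of `J`, so ℓ vertices in it would give a biclique. Hence
  -- at least ℓ vertices of `I` are private to each vertex of `W` against `x`.
  have hxI : (I.filter (G.Adj x)).card < ℓ := by
    by_contra! hc
    exact hK hJ (hI.subset (Finset.coe_subset.2 (Finset.filter_subset _ _))) hJc hc
      fun j hj i hi => hxmin j hj i (Finset.mem_filter.1 hi).1 (Finset.mem_filter.1 hi).2
  have hsum := I.card_filter_add_card_filter_not (G.Adj x)
  have hpriv : ∀ w ∈ W, ¬ G.HasIndep ℓ (G.neighborSet x \ G.neighborSet w) := by
    intro w hw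
    refine hpair w (hWJ hw) x hx ⟨I.filter fun i => ¬ G.Adj x i, fun i hi => ?_,
      hI.subset (Finset.coe_subset.2 (Finset.filter_subset _ _)), by omega⟩
    obtain ⟨hi, hxi⟩ := Finset.mem_filter.1 (Finset.mem_coe.1 hi)
    exact ⟨(Finset.mem_filter.1 hw).2 i hi, hxi⟩
  have hxW : x ∉ W := by
    intro hxW
    rw [Finset.filter_true_of_mem (Finset.mem_filter.1 hxW).2] at hxI
    omega
  obtain ⟨I', hI'x, hI', hI'c⟩ := hbig x hx
  obtain ⟨w, hw, hwmin⟩ := hP.exists_minimal_trace hJ hx hI' hI'x hWJ ⟨v, hvW⟩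
  have hsum' := I'.card_filter_add_card_filter_not (G.Adj w)
  have hfew : (I'.filter fun i => ¬ G.Adj w i).card < ℓ := by
    by_contra! hc
    refine hpriv w hw ⟨_, fun i hi => ?_,
      hI'.subset (Finset.coe_subset.2 (Finset.filter_subset _ _)), hc⟩
    obtain ⟨hi, hwi⟩ := Finset.mem_filter.1 (Finset.mem_coe.1 hi)
    exact ⟨hI'x i hi, hwi⟩
  -- Deleting the few non-neighbours of `w` from `I'` leaves a set complete to `W` and also to `x ∉
  -- W`, against the choice of `I`.
  have hle := hmax _ ⟨x, hx, I'.filter (G.Adj w), fun i hi => hI'x i (Finset.mem_filter.1 hi).1,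
    hI'.subset (Finset.coe_subset.2 (Finset.filter_subset _ _)), by omega, rfl⟩
  have hsub : insert x W ⊆ J.filter fun j => ∀ i ∈ I'.filter (G.Adj w), G.Adj j i := by
    intro j hj
    rcases Finset.mem_insert.1 hj with rfl | hjW
    · exact Finset.mem_filter.2 ⟨hx, fun i hi => hI'x i (Finset.mem_filter.1 hi).1⟩
    · exact Finset.mem_filter.2 ⟨hWJ hjW, fun i hi =>
        hwmin j hjW i (Finset.mem_filter.1 hi).1 (Finset.mem_filter.1 hi).2⟩
  have := Finset.card_le_card hsub
  rw [Finset.card_insert_of_notMem hxW] at this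
  omega

/-- Suppose that all connected subsets of `C` with large independence number see the whole outer
neighbourhood of `C`, and no two of them are anticomplete. Then of two nonadjacent vertices of `C`
at most one has a large independent set of private neighbours. -/
theorem Anchored.not_hasIndep_private {P : Set V → Prop} {C : Set V} (h : G.Anchored P ∅ C)
    (hP : G.NoInducedP5) (hK : G.NoInducedBiclique ℓ) (hℓ : 0 < ℓ) (hC : G.CutConnected C)
    (hfull : ∀ E ⊆ C, G.CutConnected E → G.HasIndep ℓ E → ∀ s ∈ G.outerNbhd ∅ C, ∃ e ∈ E, G.Adj s e)
    (hanti : ∀ E ⊆ C, G.CutConnected E → G.HasIndep ℓ E → ∀ F ⊆ C, G.CutConnected F →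
      G.HasIndep ℓ F → ¬ G.Anticomplete E F) {v w : V} (hv : v ∈ C) (hw : w ∈ C)
    (hvw : ¬ G.Adj v w) (hpv : G.HasIndep ℓ (G.neighborSet v \ G.neighborSet w)) :
    ¬ G.HasIndep ℓ (G.neighborSet w \ G.neighborSet v) := by
  rintro ⟨N, hN, hNi, hNc⟩
  obtain ⟨M, hM, hMi, hMc⟩ := hpv
  have hMv : ∀ m ∈ M, G.Adj v m := fun m hm => (hM hm).1
  have hMw : ∀ m ∈ M, ¬ G.Adj w m := fun m hm => (hM hm).2
  have hNw : ∀ n ∈ N, G.Adj w n := fun n hn => (hN hn).1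
  have hNv : ∀ n ∈ N, ¬ G.Adj v n := fun n hn => (hN hn).2
  -- One edge `m n` spreads: the paths `v m n w n'` and `w n' m v m'` are not induced, so `M` would
  -- be complete to `N`, a biclique.
  have hMN : ∀ m ∈ M, ∀ n ∈ N, ¬ G.Adj m n := by
    intro m hm n hn hmn
    have h₁ : ∀ n' ∈ N, G.Adj m n' := by
      intro n' hn'
      by_contra hmn'
      exact hP (hMv m hm) hmn (hNw n hn).symm (hNw n' hn') (hNv n hn) hvw (hNv n' hn')
        (fun h => hMw m hm h.symm) hmn' (hNi.not_adj hn hn')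
    refine hK hMi hNi hMc hNc fun m' hm' n' hn' => ?_
    by_contra hmn'
    exact hP (hNw n' hn') (h₁ n' hn').symm (hMv m hm).symm (hMv m' hm') (hMw m hm)
      (fun h => hvw h.symm) (hMw m' hm') (fun h => hNv n' hn' h.symm) (fun h => hmn' h.symm)
      (hMi.not_adj hm hm')
  have hvM : G.HasIndep ℓ (insert v (M : Set V)) := ⟨M, Set.subset_insert _ _, hMi, hMc⟩
  have hwN : G.HasIndep ℓ (insert w (N : Set V)) := ⟨N, Set.subset_insert _ _, hNi, hNc⟩
  have hcM : G.CutConnected (insert v (M : Set V)) := .star hMv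
  have hcN : G.CutConnected (insert w (N : Set V)) := .star hNw
  by_cases hMC : (M : Set V) ⊆ C
  · by_cases hNC : (N : Set V) ⊆ C
    · refine hanti _ (Set.insert_subset hv hMC) hcM hvM _ (Set.insert_subset hw hNC) hcN hwN ?_
      -- A private neighbour is needed to exclude `v = w`.
      obtain ⟨m₀, hm₀⟩ := Finset.card_pos.1 (hℓ.trans_le hMc)
      rintro x (rfl | hx)
      · refine ⟨?_, ?_⟩
        · rintro (rfl | hxN)
          · exact hMw m₀ hm₀ (hMv m₀ hm₀)
          · exact hvw (hNw _ hxN).symm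
        · rintro y (rfl | hy)
          exacts [hvw, hNv y hy]
      · refine ⟨?_, ?_⟩
        · rintro (rfl | hxN)
          · exact hvw (hMv _ hx)
          · exact hMw x hx (hNw x hxN)
        · rintro y (rfl | hy)
          exacts [fun h => hMw x hx h.symm, hMN x hx y hy]
    · obtain ⟨s, hs, hsC⟩ := Set.not_subset.1 hNC
      obtain ⟨e, rfl | he, hse⟩ := hfull _ (Set.insert_subset hv hMC) hcM hvM s
        ⟨hsC, by simp, w, hw, (hNw s hs).symm⟩
      exacts [hNv s hs hse.symm, hMN e he s hs hse.symm]
  obtain ⟨s, hs, hsC⟩ := Set.not_subset.1 hMC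
  have hsS : s ∈ G.outerNbhd ∅ C := ⟨hsC, by simp, v, hv, (hMv s hs).symm⟩
  by_cases hNC : (N : Set V) ⊆ C
  · obtain ⟨e, rfl | he, hse⟩ := hfull _ (Set.insert_subset hw hNC) hcN hwN s hsS
    exacts [hMw s hs hse.symm, hMN s hs e he hse]
  obtain ⟨t, ht, htC⟩ := Set.not_subset.1 hNC
  have htS : t ∈ G.outerNbhd ∅ C := ⟨htC, by simp, w, hw, (hNw t ht).symm⟩
  have hst : ¬ G.Adj s t := hMN s hs t ht
  -- Both `s` and `t` are mixed on `C`, so a vertex `b` of a common anchor closes the induced path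
  -- `v s b t w`.
  obtain ⟨B, hB, -, hBC, hstB⟩ := h.exists_complete hP hC (M := {s, t})
    (by rintro x (rfl | rfl) <;> assumption)
    (by
      rintro x (rfl | rfl) y (rfl | rfl) hxy
      exacts [absurd rfl hxy, hst, fun h => hst h.symm, absurd rfl hxy])
    (by
      rintro x (rfl | rfl)
      exacts [⟨w, hw, fun h => hMw _ hs h.symm⟩, ⟨v, hv, fun h => hNv _ ht h.symm⟩])
    ⟨s, Or.inl rfl⟩
  obtain ⟨b, hb⟩ := hB.1
  exact hP (hMv s hs) (hstB s (Or.inl rfl) b hb) (hstB t (Or.inr rfl) b hb).symm (hNw t ht).symm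
    (fun h => (hBC b hb).2 v hv h.symm) (hNv t ht) hvw hst (fun h => hMw s hs h.symm)
    ((hBC b hb).2 w hw)

/-! ### The main recursion. -/

theorem IndepLE.of_card_lt {k : ℕ} {s : Set V}
    (h : ∀ M : Finset V, (M : Set V) ⊆ s → G.IsIndepSet (M : Set V) → M.card < k) : G.IndepLE k s :=
  fun M hM hi => (h M hM hi).le

/-- A set is small if all its vertices are complete to one of two sets of large independence
number. -/
theorem NoInducedBiclique.indepLE_of_complete_or (hK : G.NoInducedBiclique ℓ) {s A B : Set V}
    (hA : G.HasIndep ℓ A) (hB : G.HasIndep ℓ B)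
    (h : ∀ v ∈ s, (∀ a ∈ A, G.Adj v a) ∨ ∀ b ∈ B, G.Adj v b) : G.IndepLE (2 * ℓ) s := by
  rw [two_mul]
  refine IndepLE.mono (t := {v | ∀ a ∈ A, G.Adj v a} ∪ {v | ∀ b ∈ B, G.Adj v b})
    (.union (.of_card_lt fun M hM hi => hK.card_lt hi hA hM)
      (.of_card_lt fun M hM hi => hK.card_lt hi hB hM)) h le_rfl

/-- The bound 3ℓ on the outer neighbourhood is kept through the induction. If `C` has no ℓ
independent vertices, taking all of `C` into the bag costs at most ℓ more. Otherwise the bound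
improves to 2ℓ, which leaves room for a boundary. -/
theorem Anchored.splittable [Finite V] (hP : G.NoInducedP5) (hK : G.NoInducedBiclique ℓ)
    (hℓ : 0 < ℓ) {C : Set V} (hC : G.CutConnected C) (h : G.Anchored (G.HasIndep ℓ) ∅ C)
    (hS : G.IndepLE (3 * ℓ) (G.outerNbhd ∅ C)) : G.Splittable (4 * ℓ) ∅ C := by
  classical
  induction hn : C.ncard using Nat.strong_induction_on generalizing C with
  | _ n ih =>
  subst hn
  have step : ∀ Z ⊆ C, Z.Nonempty → G.IndepLE (3 * ℓ) (G.outerNbhd ∅ C ∪ Z) →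
      (∀ D, G.IsPart D (C \ Z) → G.Anchored (G.HasIndep ℓ) ∅ D) → G.Splittable (4 * ℓ) ∅ C := by
    intro Z hZC hZ hZk hZD
    exact .intro C Z hZC (hZk.mono subset_rfl (by omega)) fun D hD =>
      ih _ (hD.ncard_lt hZC hZ) hD.1 (hZD D hD) (hZk.mono hD.outerNbhd_subset le_rfl) rfl
  by_cases hCbig : G.HasIndep ℓ C
  swap
  · refine .intro C C subset_rfl ((hS.union (.of_not_hasIndep hCbig)).mono subset_rfl (by omega))
      fun D hD => ?_
    obtain ⟨d, hd⟩ := hD.1.1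
    exact absurd (hD.2.1 hd) (by simp)
  have hmono : ∀ ⦃A B : Set V⦄, A ⊆ B → G.HasIndep ℓ A → G.HasIndep ℓ B :=
    fun _ _ hAB hA => hA.mono hAB
  have hS2 : G.IndepLE (2 * ℓ) (G.outerNbhd ∅ C) := by
    rw [two_mul]
    refine IndepLE.mono (t := {v | ∀ c ∈ C, G.Adj v c} ∪
      {v | v ∈ G.outerNbhd ∅ C ∧ ∃ c ∈ C, ¬ G.Adj v c})
      (.union (.of_card_lt fun M hM hi => hK.card_lt hi hCbig hM)
        (.of_card_lt fun M hM hi => ?_)) (fun v hv => ?_) le_rfl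
    · rcases M.eq_empty_or_nonempty with rfl | hne
      · simpa using hℓ
      obtain ⟨B, -, hB, -, hMB⟩ := h.exists_complete hP hC (fun m hm => (hM hm).1) hi
        (fun m hm => (hM hm).2) hne
      exact hK.card_lt hi hB hMB
    · by_cases hvC : ∀ c ∈ C, G.Adj v c
      · exact Or.inl hvC
      · push Not at hvC
        exact Or.inr ⟨hv, hvC⟩
  by_cases hex : ∃ E ⊆ C, G.CutConnected E ∧ G.HasIndep ℓ E ∧
      ∃ s ∈ G.outerNbhd ∅ C, ∀ e ∈ E, ¬ G.Adj s e
  · obtain ⟨E, -, Z, hZC, -, hEbig, hZne, hZE, -, hD⟩ :=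
      h.exists_boundary_of_not_full hmono hP hC hex
    exact step Z hZC hZne ((hS2.union (.of_card_lt fun M hM hi => hK.card_lt hi hEbig
      fun m hm => hZE m (hM hm))).mono subset_rfl (by omega)) hD
  push Not at hex
  by_cases hex2 : ∃ E ⊆ C, G.CutConnected E ∧ G.HasIndep ℓ E ∧
      ∃ F ⊆ C, G.CutConnected F ∧ G.HasIndep ℓ F ∧ G.Anticomplete E F
  · obtain ⟨E, hEC, Z, hZC, hE, hEbig, hZne, ⟨F, hFC, hF, hFbig, hEF⟩, hSE, hSF, hD⟩ :=
      exists_boundary_of_full hmono hC hex hex2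
    refine step Z hZC hZne ((hK.indepLE_of_complete_or hEbig hFbig fun v hv => ?_).mono subset_rfl
      (by omega)) hD
    by_contra! hcon
    obtain ⟨⟨e', he', hve'⟩, f', hf', hvf'⟩ := hcon
    obtain ⟨e, he, hve⟩ := hSE v hv
    obtain ⟨f, hf, hvf⟩ := hSF F hFC hF hFbig hEF v hv
    exact hvf' (hP.adj_of_anticomplete hF hE hEF.symm he hve he' hve' hf hvf hf')
  push Not at hex2
  set X : Set V := {v | v ∈ C ∧ ¬ G.IndepLE (3 * ℓ) (G.neighborSet v)} with hX
  have hXC : X ⊆ C := fun x hx => hx.1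
  have hXle : G.IndepLE ℓ X := .of_card_lt fun J hJ hi => hK.card_lt_of_private hP hi
    (fun v hv w hw => h.not_hasIndep_private hP hK hℓ hC hex hex2 (hJ hv).1 (hJ hw).1
      (hi.not_adj hv hw)) fun v hv => (hJ hv).2
  refine .intro C X hXC ((hS.union hXle).mono subset_rfl (by omega)) fun D hD => ?_
  have hDC : D ⊆ C := fun d hd => (hD.2.1 hd).1
  have hDS : G.outerNbhd X D ⊆ G.outerNbhd ∅ C := by
    rintro v ⟨hvD, hvX, d, hd, hvd⟩
    exact ⟨fun hvC => hvD (hD.2.2 d hd v ⟨hvC, hvX⟩ hvd.symm), by simp, d, hDC hd, hvd⟩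
  -- Vertices of `X` need not be anchored for `D`; they are ignored inside `D` and put into all bags
  -- afterwards.
  have hspl : G.Splittable (3 * ℓ) X D := by
    refine Anchored.splittable_of_indepLE_neighborSet hP (by omega) hD.1 (fun M hM hi hm hne => ?_)
      (hS.mono hDS le_rfl) fun d hd => ?_
    · obtain ⟨B, hB, -, hBD⟩ := h.of_subset hDC (hM.trans hDS) hi hm hne
      exact ⟨B, hB, trivial, hBD⟩
    · by_contra hcon
      exact (hD.2.1 hd).2 ⟨hDC hd, hcon⟩
  have := hspl.of_ignored hXle
  rwa [show 3 * ℓ + ℓ = 4 * ℓ by ring] at this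

end SimpleGraph

theorem mainTheorem1 (ℓ : ℕ) (hℓ : 0 < ℓ) {V : Type u} [Finite V] (G : SimpleGraph V)
    (hP : ¬ (SimpleGraph.pathGraph 5).IsIndContained G)
    (hK : ¬ (completeBipartiteGraph (Fin ℓ) (Fin ℓ)).IsIndContained G) :
    G.treeIndepNum ≤ 4 * ℓ := by
  have hempty : ∀ E : Set V, G.IsPart E Set.univ → G.outerNbhd ∅ E = ∅ := by
    rintro E hE
    refine Set.eq_empty_iff_forall_notMem.2 ?_
    rintro v ⟨hv, -, e, he, hve⟩
    exact hv (hE.2.2 e he v trivial hve.symm)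
  have huniv : G.outerNbhd ∅ Set.univ = ∅ :=
    Set.eq_empty_iff_forall_notMem.2 fun v hv => hv.1 trivial
  have h₀ : ∀ k, G.IndepLE k ∅ := fun k M hM _ => by
    simp [Finset.coe_eq_empty.1 (Set.subset_empty_iff.1 hM)]
  have hspl : G.Splittable (4 * ℓ) ∅ Set.univ := by
    -- An empty root bag splits the graph into its components, which have empty outer neighbourhoods
    -- and so are vacuously anchored.
    refine .intro Set.univ ∅ (Set.empty_subset _) (by simpa [huniv] using h₀ _) fun E hE => ?_
    rw [Set.sdiff_empty] at hE
    refine SimpleGraph.Anchored.splittable (SimpleGraph.noInducedP5_of_not_isIndContained hP)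
      (SimpleGraph.noInducedBiclique_of_not_isIndContained hK) hℓ hE.1 ?_
      (by simpa [hempty E hE] using h₀ _)
    rintro M hM - - ⟨m, hm⟩
    exact absurd (hM hm) (by simp [hempty E hE])
  have := hspl.rootedDecomposable
  rw [Set.univ_union] at this
  exact this.treeIndepNum_le
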